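/- Let $[u,v]=u^{-1}v^{-1}uv$. Let $s\ge 0$. There is a constant $C=C(s)\in\mathbb{N}$, depending only on $s$, such that the following holds. Let $G$ be a nilpotent group of step at most $s$, let $x_1,\ldots,x_r\in G$, and let $L=(L_1,\ldots,L_r)$ be a vector of positive integers. Define the ordered progression $$P_{\mathrm{ord}}(x_1,\ldots,x_r;L)=\{x_1^{l_1}\cdots x_r^{l_r}: l_i\in\mathbb{Z},\ |l_i|\le L_i\},$$ and define the nilprogression $P^*(x_1,\ldots,x_r;L)$ to be the set of all products in the $x_i$ and their inverses in which each $x_i$ and its inverse appear at most $L_i$ times between them. Formal commutators in the letters $x_1,\ldots,x_r$ are defined recursively: each letter $x_i$ is one, with weight vector $\chi(x_i)=e_i\in\mathbb{N}_0^r$, and if $\alpha,\beta$ are formal commutators then so is $[\alpha,\beta]$, with $\chi([\alpha,\beta])=\chi(\alpha)+\chi(\beta)$. The total weight of $\alpha$ is $\|\chi(\alpha)\|_1$. Let $\prec$ be any strict total order on the formal commutators such that $x_1\prec\cdots\prec x_r$, commutators with the same weight vector are consecutive, and commutators of lower total weight precede those of higher total weight. The basic commutators (with respect to $\prec$) are defined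 recursively: each $x_i$ is basic, and $[\alpha,\beta]$ is basic if $\alpha,\beta$ are basic, $\beta\prec\alpha$ and, in case $\alpha=[\alpha_1,\alpha_2]$, also $\alpha_2\preceq\beta$. Let $c_1\prec\cdots\prec c_t$ be the list of all basic commutators of total weight at most the nilpotency class of $G$, interpreted also as elements of $G$. Define the nilpotent progression $$P(x_1,\ldots,x_r;L)=\{c_1^{l_1}\cdots c_t^{l_t}: l_i\in\mathbb{Z},\ |l_i|\le L^{\chi(c_i)}\},\qquad L^{\chi}=L_1^{\chi_1}\cdots L_r^{\chi_r}.$$ Then $$P_{\mathrm{ord}}(x_1,\ldots,x_r;L)\subset P^*(x_1,\ldots,x_r;L)\subset P(x_1,\ldots,x_r;L)\subset P_{\mathrm{ord}}(x_1,\ldots,x_r;L)^{r^{C}},$$ where $A^n$ denotes the set of all $n$-fold products of elements of $A$. -/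

import Mathlib

open scoped Pointwise

universe u

namespace NilProg

/-- Formal commutators in the letters `x_1, …, x_r` (indexed by `Fin r`): every letter is a formal
commutator, and so is the formal bracket `[α, β]` of two formal commutators. -/
inductive FormalComm (r : ℕ) : Type
  | letter : Fin r → FormalComm r
  | bracket : FormalComm r → FormalComm r → FormalComm r

namespace FormalComm

variable {r : ℕ}

/-- The weight vector `χ(α) ∈ ℕ^r`: the number of occurrences of each letter in `α`. -/
def weight : FormalComm r → Fin r → ℕ
  | letter i => Pi.single i 1
  | bracket α β => weight α + weight β

/-- The total weight `|χ(α)| = ∑ i, χ(α)_i`. -/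
def totalWeight (α : FormalComm r) : ℕ := ∑ i, α.weight i

/-- The interpretation of a formal commutator at group elements `x_1, …, x_r`, with the
convention `[u, v] = u⁻¹ v⁻¹ u v`. -/
def eval {G : Type u} [Group G] (x : Fin r → G) : FormalComm r → G
  | letter i => x i
  | bracket α β => (eval x α)⁻¹ * (eval x β)⁻¹ * eval x α * eval x β

end FormalComm

/-- The admissible orderings `≺` of the formal commutators: strict total orders such that
`x_1 ≺ ⋯ ≺ x_r`, commutators with the same weight vector are consecutive, and commutators of
lower total weight come before commutators of higher total weight. -/
structure IsCommOrder {r : ℕ} (lt : FormalComm r → FormalComm r → Prop) : Prop where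
  strictTotal : IsStrictTotalOrder (FormalComm r) lt
  letters : ∀ i j : Fin r, i < j → lt (.letter i) (.letter j)
  consecutive : ∀ α β γ : FormalComm r, lt α β → lt β γ → α.weight = γ.weight →
    β.weight = α.weight
  lowerFirst : ∀ α β : FormalComm r, α.totalWeight < β.totalWeight → lt α β

/-- The basic commutators with respect to the ordering `≺` (P. Hall): the letters are basic, and
`[α, β]` is basic when `α` and `β` are basic, `β ≺ α` and, if `α = [α₁, α₂]`, then `α₂ ⪯ β`.
These are the commutators that can arise in the collecting process. -/
inductive IsBasic {r : ℕ} (lt : FormalComm r → FormalComm r → Prop) : FormalComm r → Prop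
  | letter (i : Fin r) : IsBasic lt (.letter i)
  | bracket (α β : FormalComm r) : IsBasic lt α → IsBasic lt β → lt β α →
      (∀ α₁ α₂ : FormalComm r, α = .bracket α₁ α₂ → α₂ = β ∨ lt α₂ β) →
      IsBasic lt (.bracket α β)

/-- `cs` is the complete `≺`-increasing list `c_1 ≺ ⋯ ≺ c_t` of the basic commutators of total
weight at most `n`. -/
def IsBasicList {r : ℕ} (lt : FormalComm r → FormalComm r → Prop) (n : ℕ)
    (cs : List (FormalComm r)) : Prop :=
  cs.Pairwise lt ∧ ∀ c : FormalComm r, c ∈ cs ↔ IsBasic lt c ∧ c.totalWeight ≤ n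

variable {G : Type u} [Group G] {r : ℕ}

/-- The ordered progression `P_ord(x_1, …, x_r; L) = {x_1^{l_1} ⋯ x_r^{l_r} : |l_i| ≤ L_i}`. -/
def orderedProgression (x : Fin r → G) (L : Fin r → ℕ) : Set G :=
  {g | ∃ l : Fin r → ℤ, (∀ i, |l i| ≤ (L i : ℤ)) ∧ g = (List.ofFn fun i => x i ^ l i).prod}

/-- The nilprogression `P*(x_1, …, x_r; L)`: all products in the `x_i` and their inverses in which
each `x_i` and its inverse appear at most `L_i` times between them. A word is a list of pairs
`(i, b)`, standing for `x_i` if `b` is true and for `x_i⁻¹` otherwise. -/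
def nilprogression (x : Fin r → G) (L : Fin r → ℕ) : Set G :=
  {g | ∃ w : List (Fin r × Bool), (∀ i, (w.map Prod.fst).count i ≤ L i) ∧
    g = (w.map fun p => if p.2 then x p.1 else (x p.1)⁻¹).prod}

/-- The nilpotent progression `P(x_1, …, x_r; L) = {c_1^{l_1} ⋯ c_t^{l_t} : |l_i| ≤ L^{χ(c_i)}}`
in a nilpotent group, where `c_1 ≺ ⋯ ≺ c_t` are the basic commutators in the `x_i` (those of total
weight larger than the nilpotency class are trivial in the group and are left out). -/
noncomputable def nilpotentProgression [Group.IsNilpotent G]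
    (lt : FormalComm r → FormalComm r → Prop) (x : Fin r → G) (L : Fin r → ℕ) : Set G :=
  {g | ∃ (cs : List (FormalComm r)) (l : FormalComm r → ℤ),
    IsBasicList lt (Group.nilpotencyClass G) cs ∧
    (∀ c ∈ cs, |l c| ≤ ((∏ i, L i ^ c.weight i : ℕ) : ℤ)) ∧
    g = (cs.map fun c => c.eval x ^ l c).prod}

end NilProg

/-! The first inclusion only reads an ordered product as a word. The other two rest on P. Hall's
collecting process, run with sharp counts.

For the second inclusion, basic commutators are collected to the left one at a time in increasing
order. When `β` is collected, no commutator `[γ, β]` is present yet, so the left-normed commutators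
`[α, β, …, β]` with `k` entries `β` that arise number at most `occ α * occ β ^ k`. Hence the bound
`L^χ(c)` on the occurrences of `c` is preserved with constant 1. This is `exists_collect_one`,
iterated in `exists_collect`.

For the third inclusion it suffices that `c^l`, for `|l| ≤ L^χ(c)`, is a product of `K(s)` powers
`x_i^m` with `|m| ≤ L_i` (`exists_zpow_eval_mem`), since for `r ≥ 2` the number of basic commutators
is at most a power of `r`. The proof is by induction on the class. For `c = [α, β]`, the commutator
of `α^p` and `β^q` depends only on their classes modulo the last, central term of the lower central
series, so it is short by induction. By `exists_commutator_zpow` it differs from `c^(pq)` by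
boundedly many powers of heavier commutators, which are handled by descending induction on the
weight. Division with remainder reaches every exponent `l` from products `pq`. -/

namespace NilProg

open FormalComm

/-! ### The collecting process with exact occurrence bounds. -/

section Collection

variable {r : ℕ}

noncomputable instance : DecidableEq (FormalComm r) := Classical.decEq _

theorem FormalComm.totalWeight_letter (i : Fin r) : (letter i).totalWeight = 1 := by
  simp [totalWeight, weight]

theorem FormalComm.totalWeight_bracket (α β : FormalComm r) :
    (bracket α β).totalWeight = α.totalWeight + β.totalWeight := by
  simp [totalWeight, weight, Finset.sum_add_distrib]

theorem FormalComm.totalWeight_pos (α : FormalComm r) : 0 < α.totalWeight := by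
  induction α with
  | letter i => simp [totalWeight_letter]
  | bracket α β ha hb => rw [totalWeight_bracket]; omega

/-- The value of a word in formal commutators; the sign `true` stands for the commutator itself and
`false` for its inverse. -/
def wordEval {G : Type u} [Group G] (x : Fin r → G) (w : List (FormalComm r × Bool)) : G :=
  (w.map fun p => if p.2 then p.1.eval x else (p.1.eval x)⁻¹).prod

/-- The number of occurrences of a formal commutator in a word, with either sign. -/
noncomputable def occ (w : List (FormalComm r × Bool)) (c : FormalComm r) : ℕ :=
  (w.map Prod.fst).count c

/-- The formal inverse of a word. -/
def wordInv (w : List (FormalComm r × Bool)) : List (FormalComm r × Bool) :=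
  (w.map fun p => (p.1, !p.2)).reverse

section Words

variable {G : Type u} [Group G] (x : Fin r → G)

@[simp] theorem wordEval_nil : wordEval x [] = 1 := rfl

@[simp] theorem wordEval_cons (p : FormalComm r × Bool) (w : List (FormalComm r × Bool)) :
    wordEval x (p :: w) = (if p.2 then p.1.eval x else (p.1.eval x)⁻¹) * wordEval x w := by
  simp [wordEval]

@[simp] theorem wordEval_append (v w : List (FormalComm r × Bool)) :
    wordEval x (v ++ w) = wordEval x v * wordEval x w := by
  simp [wordEval]

theorem wordEval_wordInv (w : List (FormalComm r × Bool)) :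
    wordEval x (wordInv w) = (wordEval x w)⁻¹ := by
  induction w with
  | nil => simp [wordInv]
  | cons p w ih =>
    have : wordInv (p :: w) = wordInv w ++ [(p.1, !p.2)] := by simp [wordInv]
    rw [this, wordEval_append, ih]
    cases h : p.2 <;> simp [h]

theorem wordEval_flatMap (g : G) (f : FormalComm r × Bool → List (FormalComm r × Bool))
    (hf : ∀ p, wordEval x (f p) = g⁻¹ * wordEval x [p] * g) (w : List (FormalComm r × Bool)) :
    wordEval x (w.flatMap f) = g⁻¹ * wordEval x w * g := by
  induction w with
  | nil => simp
  | cons p w ih =>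
    rw [List.flatMap_cons, wordEval_append, hf, ih, wordEval_cons, wordEval_cons, wordEval_nil]
    group

theorem wordEval_filter (P : FormalComm r → Prop) [DecidablePred P]
    (hP : ∀ c, ¬ P c → c.eval x = 1) (w : List (FormalComm r × Bool)) :
    wordEval x (w.filter fun p => P p.1) = wordEval x w := by
  induction w with
  | nil => simp
  | cons p w ih =>
    by_cases h : P p.1
    · simp [h, ih]
    · simp [h, ih, hP _ h]

end Words

@[simp] theorem occ_nil (c : FormalComm r) : occ [] c = 0 := rfl

theorem occ_cons (p : FormalComm r × Bool) (w : List (FormalComm r × Bool)) (c : FormalComm r) :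
    occ (p :: w) c = (if p.1 = c then 1 else 0) + occ w c := by
  simp [occ, List.count_cons, add_comm]

@[simp] theorem occ_append (v w : List (FormalComm r × Bool)) (c : FormalComm r) :
    occ (v ++ w) c = occ v c + occ w c := by
  simp [occ]

@[simp] theorem occ_wordInv (w : List (FormalComm r × Bool)) (c : FormalComm r) :
    occ (wordInv w) c = occ w c := by
  unfold occ wordInv
  rw [List.map_reverse, List.count_reverse, List.map_map]
  rfl

theorem mem_wordInv {w : List (FormalComm r × Bool)} {p : FormalComm r × Bool}
    (h : p ∈ wordInv w) : ∃ q ∈ w, q.1 = p.1 := by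
  simp only [wordInv, List.mem_reverse, List.mem_map] at h
  obtain ⟨q, hq, rfl⟩ := h
  exact ⟨q, hq, rfl⟩

/-- The expansion `α α₂ α₄ ⋯ α₃⁻¹ α₁⁻¹` of `β α β⁻¹`, where `α₀ = α` and `αₖ₊₁ = [αₖ, β]`, cut off
after `k` factors. -/
def conjInv (β : FormalComm r) : ℕ → FormalComm r → List (FormalComm r × Bool)
  | 0, _ => []
  | k + 1, α => (α, true) :: wordInv (conjInv β k (bracket α β))

/-- The word obtained from `α` or `α⁻¹` when `β` (if the first sign is `true`) or `β⁻¹` is moved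
to its left. -/
def pass (β : FormalComm r) (n : ℕ) (δ : Bool) (p : FormalComm r × Bool) :
    List (FormalComm r × Bool) :=
  let u := if δ then [(p.1, true), (bracket p.1 β, true)] else conjInv β n p.1
  if p.2 then u else wordInv u

/-- Iterates `β α β⁻¹ = α (β [α, β] β⁻¹)⁻¹`. Each step raises the weight, so what is cut off is
trivial. -/
theorem wordEval_conjInv {G : Type u} [Group G] (x : Fin r → G) (n : ℕ)
    (hx : ∀ c : FormalComm r, n < c.totalWeight → c.eval x = 1) (β : FormalComm r) (k : ℕ) :
    ∀ α : FormalComm r, n < α.totalWeight + k →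
      wordEval x (conjInv β k α) = β.eval x * α.eval x * (β.eval x)⁻¹ := by
  induction k with
  | zero => intro α h; simp [conjInv, hx α h]
  | succ k ih =>
    intro α h
    have hb := β.totalWeight_pos
    rw [conjInv, wordEval_cons, wordEval_wordInv, ih _ (by rw [totalWeight_bracket]; omega)]
    simp only [if_true, FormalComm.eval]
    group

theorem wordEval_pass {G : Type u} [Group G] (x : Fin r → G) (n : ℕ)
    (hx : ∀ c : FormalComm r, n < c.totalWeight → c.eval x = 1) (β : FormalComm r) (δ : Bool)
    (p : FormalComm r × Bool) :
    wordEval x (pass β n δ p) =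
      (wordEval x [(β, δ)])⁻¹ * wordEval x [p] * wordEval x [(β, δ)] := by
  obtain ⟨α, ε⟩ := p
  have hu : wordEval x (if δ then [(α, true), (bracket α β, true)] else conjInv β n α) =
      (wordEval x [(β, δ)])⁻¹ * α.eval x * wordEval x [(β, δ)] := by
    cases δ
    · have := α.totalWeight_pos
      simp [wordEval_conjInv x n hx β n α (by omega)]
    · simp [FormalComm.eval]; group
  unfold pass
  cases ε
  · simp only [Bool.false_eq_true, if_false, wordEval_wordInv, hu, wordEval_cons, wordEval_nil]
    group
  · simp only [if_true, hu, wordEval_cons, wordEval_nil]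
    group

/-- The sum of `f` over `c`, `c'`, `c''`, … where `c = [c', β]`, `c' = [c'', β]`, …. -/
noncomputable def sumTails (β : FormalComm r) (f : FormalComm r → ℕ) : FormalComm r → ℕ
  | letter i => f (letter i)
  | bracket α γ => f (bracket α γ) + if γ = β then sumTails β f α else 0

/-- For `c = [α, β, …, β]` with `k` factors `β` split off as far as possible, this is
`f α * m ^ k`. -/
noncomputable def tailBound (β : FormalComm r) (f : FormalComm r → ℕ) (m : ℕ) : FormalComm r → ℕ
  | letter i => f (letter i)
  | bracket α γ => if γ = β then tailBound β f m α * m else f (bracket α γ)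

theorem tailBound_mono (β : FormalComm r) {f g : FormalComm r → ℕ} (h : ∀ c, f c ≤ g c) {m k : ℕ}
    (hm : m ≤ k) (c : FormalComm r) : tailBound β f m c ≤ tailBound β g k c := by
  induction c with
  | letter i => exact h _
  | bracket α γ ih _ =>
    simp only [tailBound]
    split_ifs
    · exact Nat.mul_le_mul ih hm
    · exact h _

theorem sumTails_mono (β : FormalComm r) {f g : FormalComm r → ℕ} (h : ∀ c, f c ≤ g c)
    (c : FormalComm r) : sumTails β f c ≤ sumTails β g c := by
  induction c with
  | letter i => exact h _
  | bracket α γ ih _ =>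
    simp only [sumTails]
    split_ifs
    · exact Nat.add_le_add (h _) ih
    · exact Nat.add_le_add (h _) le_rfl

theorem sumTails_add (β : FormalComm r) (f g : FormalComm r → ℕ) (c : FormalComm r) :
    sumTails β (fun d => f d + g d) c = sumTails β f c + sumTails β g c := by
  induction c with
  | letter i => rfl
  | bracket α γ ih _ =>
    simp only [sumTails]
    split_ifs <;> omega

/-- This is `m^k + ⋯ + m + 1 ≤ (m + 1)^k + ⋯`-type bookkeeping in its sharp form `∑_{j ≤ k} m^j ≤ (m
+ 1)^k`: collecting one more `β` replaces `m` by `m + 1`. -/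
theorem sumTails_tailBound (β : FormalComm r) (f : FormalComm r → ℕ) (m : ℕ) (c : FormalComm r) :
    sumTails β (tailBound β f m) c ≤ tailBound β f (m + 1) c := by
  induction c with
  | letter i => exact le_rfl
  | bracket α γ ih _ =>
    simp only [sumTails, tailBound]
    split_ifs
    · have := tailBound_mono β (fun c => le_refl (f c)) (Nat.le_succ m) α
      simp only [Nat.succ_eq_add_one] at this
      nlinarith
    · simp

/-- Stripping entries `β` from `c` reaches `α` either at once or just after `[α, β]`. -/
theorem sumTails_single (β α c : FormalComm r) :
    sumTails β (fun d => if bracket α β = d then 1 else 0) c + (if α = c then 1 else 0) ≤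
      sumTails β (fun d => if α = d then 1 else 0) c := by
  induction c with
  | letter i => simp [sumTails]
  | bracket δ γ ih _ =>
    simp only [sumTails]
    by_cases h : γ = β
    · subst h
      simp only [if_true, FormalComm.bracket.injEq, and_true]
      omega
    · have : ¬ β = γ := fun e => h e.symm
      simp [h, this]

theorem occ_conjInv (β : FormalComm r) (k : ℕ) : ∀ α c : FormalComm r,
    occ (conjInv β k α) c ≤ sumTails β (fun d => if α = d then 1 else 0) c := by
  induction k with
  | zero => intro α c; simp [conjInv]
  | succ k ih =>
    intro α c
    rw [conjInv, occ_cons, occ_wordInv]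
    have h1 := ih (bracket α β) c
    have h2 := sumTails_single β α c
    dsimp only
    omega

theorem le_sumTails (β : FormalComm r) (f : FormalComm r → ℕ) (c : FormalComm r) :
    f c ≤ sumTails β f c := by
  cases c <;> simp [sumTails]

theorem occ_pass (β : FormalComm r) (n : ℕ) (δ : Bool) (p : FormalComm r × Bool)
    (c : FormalComm r) :
    occ (pass β n δ p) c ≤ sumTails β (fun d => if p.1 = d then 1 else 0) c := by
  have hu : occ (if δ then [(p.1, true), (bracket p.1 β, true)] else conjInv β n p.1) c ≤
      sumTails β (fun d => if p.1 = d then 1 else 0) c := by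
    cases δ
    · simpa using occ_conjInv β n p.1 c
    · have h2 := sumTails_single β p.1 c
      have h3 := le_sumTails β (fun d => if bracket p.1 β = d then 1 else 0) c
      simp only [if_true, occ_cons, occ_nil]
      omega
  unfold pass
  cases p.2 <;> simpa using hu

theorem occ_flatMap_pass (β : FormalComm r) (n : ℕ) (δ : Bool) (w : List (FormalComm r × Bool))
    (c : FormalComm r) : occ (w.flatMap (pass β n δ)) c ≤ sumTails β (occ w) c := by
  induction w with
  | nil => simp
  | cons p w ih =>
    have : occ (p :: w) = fun d => (if p.1 = d then 1 else 0) + occ w d :=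
      funext fun d => occ_cons p w d
    rw [List.flatMap_cons, occ_append, this, sumTails_add]
    exact Nat.add_le_add (occ_pass β n δ p c) ih

theorem forall_mem_conjInv (P : FormalComm r → Prop) (β : FormalComm r)
    (hP : ∀ α, P α → P (bracket α β)) (k : ℕ) :
    ∀ α, P α → ∀ p ∈ conjInv β k α, P p.1 := by
  induction k with
  | zero => intro α _ p hp; simp [conjInv] at hp
  | succ k ih =>
    intro α hα p hp
    rw [conjInv, List.mem_cons] at hp
    rcases hp with rfl | hp
    · exact hα
    · obtain ⟨q, hq, hqp⟩ := mem_wordInv hp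
      rw [← hqp]
      exact ih _ (hP _ hα) q hq

theorem forall_mem_pass (P : FormalComm r → Prop) (β : FormalComm r)
    (hP : ∀ α, P α → P (bracket α β)) (n : ℕ) (δ : Bool) (p : FormalComm r × Bool) (hp : P p.1) :
    ∀ q ∈ pass β n δ p, P q.1 := by
  have hu : ∀ q ∈ (if δ then [(p.1, true), (bracket p.1 β, true)] else conjInv β n p.1),
      P q.1 := by
    cases δ
    · simpa using fun a b h => forall_mem_conjInv P β hP n p.1 hp (a, b) h
    · simp [hp, hP]
  intro q hq
  unfold pass at hq
  cases h : p.2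
  · simp only [h, Bool.false_eq_true, if_false] at hq
    obtain ⟨q', hq', hqq⟩ := mem_wordInv hq
    rw [← hqq]; exact hu q' hq'
  · simp only [h, if_true] at hq
    exact hu q hq

/-- One stage of the collecting process: all occurrences of `β` are moved to the left. -/
theorem exists_collect_one {G : Type u} [Group G] (x : Fin r → G) (n : ℕ)
    (hx : ∀ c : FormalComm r, n < c.totalWeight → c.eval x = 1)
    {lt : FormalComm r → FormalComm r → Prop}
    (hlow : ∀ α β : FormalComm r, α.totalWeight < β.totalWeight → lt α β)
    (β : FormalComm r) (hβ : IsBasic lt β) (w : List (FormalComm r × Bool))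
    (hw : ∀ p ∈ w, p.1 = β ∨ (IsBasic lt p.1 ∧ lt β p.1))
    (hw' : ∀ p ∈ w, ∀ α γ, p.1 = bracket α γ → lt γ β ∧ γ ≠ β) :
    ∃ (e : ℤ) (v : List (FormalComm r × Bool)),
      wordEval x w = β.eval x ^ e * wordEval x v ∧ |e| ≤ occ w β ∧
      (∀ p ∈ v, IsBasic lt p.1 ∧ lt β p.1 ∧ ∀ α γ, p.1 = bracket α γ → γ = β ∨ lt γ β) ∧
      ∀ c, occ v c ≤ tailBound β (occ w) (occ w β) c := by
  induction w using List.reverseRecOn with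
  | nil => exact ⟨0, [], by simp, by simp, by simp, by simp⟩
  | append_singleton w p ih =>
    obtain ⟨e, v, h1, h2, h3, h4⟩ := ih (fun q hq => hw q (by simp [hq]))
      (fun q hq => hw' q (by simp [hq]))
    have hmono : ∀ c, occ w c ≤ occ (w ++ [p]) c := fun c => by simp
    by_cases hp : p.1 = β
    · refine ⟨e + (if p.2 then 1 else -1), v.flatMap (pass β n p.2), ?_, ?_, ?_, ?_⟩
      -- With `δ = ±1`, `β^e v β^δ = β^(e+δ) (β^(-δ) v β^δ)`, and the conjugate is expanded letter
      -- by letter.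
      · rw [wordEval_flatMap x _ _ (wordEval_pass x n hx β p.2), wordEval_append, h1, zpow_add]
        obtain ⟨p1, p2⟩ := p
        simp only at hp
        subst hp
        cases p2 <;> simp <;> group
      · have : occ (w ++ [p]) β = occ w β + 1 := by simp [occ_cons, hp]
        rw [this]
        push_cast
        refine (abs_add_le _ _).trans (add_le_add h2 ?_)
        split_ifs <;> simp
      · intro q hq
        obtain ⟨q', hq', hq⟩ := List.mem_flatMap.1 hq
        refine forall_mem_pass (fun c => IsBasic lt c ∧ lt β c ∧
          ∀ α γ, c = bracket α γ → γ = β ∨ lt γ β) β ?_ n p.2 q' (h3 q' hq') q hq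
        rintro α ⟨ha1, ha2, ha3⟩
        -- The invariant that right entries are `⪯ β` is exactly what makes `[α, β]` basic.
        refine ⟨.bracket _ _ ha1 hβ ha2 ha3, hlow _ _ ?_, ?_⟩
        · have := α.totalWeight_pos
          rw [totalWeight_bracket]; omega
        · intro α' γ h
          simp only [FormalComm.bracket.injEq] at h
          exact .inl h.2.symm
      · intro c
        have : occ (w ++ [p]) β = occ w β + 1 := by simp [occ_cons, hp]
        calc _ ≤ sumTails β (occ v) c := occ_flatMap_pass _ _ _ _ _
          _ ≤ sumTails β (tailBound β (occ w) (occ w β)) c := sumTails_mono β h4 c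
          _ ≤ tailBound β (occ w) (occ w β + 1) c := sumTails_tailBound _ _ _ _
          _ ≤ _ := tailBound_mono β hmono this.ge c
    · refine ⟨e, v ++ [p], ?_, ?_, ?_, ?_⟩
      · rw [wordEval_append, wordEval_append, h1, mul_assoc]
      · exact h2.trans (by exact_mod_cast hmono β)
      · intro q hq
        rw [List.mem_append, List.mem_singleton] at hq
        rcases hq with hq | rfl
        · exact h3 q hq
        · have := (hw q (by simp)).resolve_left hp
          exact ⟨this.1, this.2, fun α γ h => .inr (hw' q (by simp) α γ h).1⟩
      · intro c
        rw [occ_append, occ_cons, occ_nil, add_zero]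
        by_cases hc : p.1 = c
        -- An original letter of the word never has right entry `β`, so its bound has no factor `m`.
        · have hb : ∀ f m, tailBound β f m c = f c := by
            intro f m
            cases hcc : c with
            | letter i => rfl
            | bracket α γ => simp [tailBound, (hw' p (by simp) α γ (hc.trans hcc)).2]
          have := h4 c
          rw [hb] at this ⊢
          simp [occ_cons, hc, this]
        · simp only [hc, if_false, add_zero]
          exact (h4 c).trans (tailBound_mono β hmono (hmono β) c)

/-- Supermultiplicativity gives `B α * B β ^ k ≤ B [α, β, …, β]`, so one stage of collection
preserves the bound `B`. -/
theorem tailBound_le (B : FormalComm r → ℕ) (hB : ∀ α β, B α * B β ≤ B (bracket α β))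
    (β : FormalComm r) (f : FormalComm r → ℕ) (hf : ∀ c, f c ≤ B c) (m : ℕ) (hm : m ≤ B β)
    (c : FormalComm r) : tailBound β f m c ≤ B c := by
  induction c with
  | letter i => exact hf _
  | bracket α γ ih _ =>
    simp only [tailBound]
    split_ifs with h
    · subst h; exact (Nat.mul_le_mul ih hm).trans (hB _ _)
    · exact hf _

/-- The collecting process, for words in the commutators of a final segment `cs` of the basic
commutators. -/
theorem exists_collect_aux {G : Type u} [Group G] (x : Fin r → G) (n : ℕ)
    (hx : ∀ c : FormalComm r, n < c.totalWeight → c.eval x = 1)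
    {lt : FormalComm r → FormalComm r → Prop} (hst : IsStrictTotalOrder (FormalComm r) lt)
    (hlow : ∀ α β : FormalComm r, α.totalWeight < β.totalWeight → lt α β)
    (B : FormalComm r → ℕ) (hB : ∀ α β, B α * B β ≤ B (bracket α β))
    (cs : List (FormalComm r)) (hcs : cs.Pairwise lt) (hbas : ∀ c ∈ cs, IsBasic lt c)
    (hup : ∀ c ∈ cs, ∀ d, IsBasic lt d → d.totalWeight ≤ n → lt c d → d ∈ cs)
    (w : List (FormalComm r × Bool)) (hw : ∀ p ∈ w, p.1 ∈ cs)
    (hw' : ∀ p ∈ w, ∀ α γ, p.1 = bracket α γ → ∀ c ∈ cs, lt γ c)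
    (hocc : ∀ c, occ w c ≤ B c) :
    ∃ l : FormalComm r → ℤ, (∀ c ∈ cs, |l c| ≤ (B c : ℤ)) ∧
      wordEval x w = (cs.map fun c => c.eval x ^ l c).prod := by
  induction cs generalizing w with
  | nil =>
    have : w = [] := List.eq_nil_iff_forall_not_mem.2 fun p hp => by simpa using hw p hp
    exact ⟨0, by simp, by simp [this]⟩
  | cons β cs ih =>
    rw [List.pairwise_cons] at hcs
    have hirr : ∀ c, ¬ lt c c := hst.irrefl
    obtain ⟨e, v, h1, h2, h3, h4⟩ := exists_collect_one x n hx hlow β (hbas β (by simp)) w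
      (fun p hp => by
        rcases List.mem_cons.1 (hw p hp) with h | h
        · exact .inl h
        · exact .inr ⟨hbas _ (by simp [h]), hcs.1 _ h⟩)
      (fun p hp α γ h => by
        have := hw' p hp α γ h β (by simp)
        exact ⟨this, fun e => hirr β (e ▸ this)⟩)
    have hcsmem : ∀ c, IsBasic lt c → c.totalWeight ≤ n → lt β c → c ∈ cs := by
      intro c hc hn hl
      rcases List.mem_cons.1 (hup β (by simp) c hc hn hl) with h | h
      · exact absurd (h ▸ hl) (hirr _)
      · exact h
    obtain ⟨l, hl1, hl2⟩ := ih hcs.2 (fun c hc => hbas c (by simp [hc]))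
      (fun c hc d hd hn hl => hcsmem d hd hn (hst.trans _ _ _ (hcs.1 c hc) hl))
      -- Commutators heavier than `n` are trivial; dropping them keeps the word inside the finite
      -- list.
      (v.filter fun p => p.1.totalWeight ≤ n)
      (fun p hp => by
        simp only [List.mem_filter, decide_eq_true_eq] at hp
        exact hcsmem _ (h3 p hp.1).1 hp.2 (h3 p hp.1).2.1)
      (fun p hp α γ h c hc => by
        simp only [List.mem_filter] at hp
        rcases (h3 p hp.1).2.2 α γ h with rfl | h
        · exact hcs.1 c hc
        · exact hst.trans _ _ _ h (hcs.1 c hc))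
      (fun c => by
        refine le_trans ?_ ((h4 c).trans (tailBound_le B hB β _ hocc _ (hocc β) c))
        exact (List.filter_sublist.map _).count_le c)
    refine ⟨fun c => if c = β then e else l c, ?_, ?_⟩
    · intro c hc
      dsimp only
      split_ifs with h
      · subst h; exact h2.trans (by exact_mod_cast hocc c)
      · exact hl1 c ((List.mem_cons.1 hc).resolve_left h)
    · rw [h1, List.map_cons, List.prod_cons,
        ← wordEval_filter x (fun c => c.totalWeight ≤ n) (fun c hc => hx c (by omega)) v, hl2]
      simp only [if_true]
      congr 2
      refine List.map_congr_left fun c hc => ?_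
      have : c ≠ β := fun h => hirr β (h ▸ hcs.1 c hc)
      simp [this]

/-- The collecting process: a word in the letters is a product of powers of the basic commutators,
with exponents bounded by any supermultiplicative bound for the numbers of occurrences of the
letters. -/
theorem exists_collect {G : Type u} [Group G] (x : Fin r → G) (n : ℕ)
    (hx : ∀ c : FormalComm r, n < c.totalWeight → c.eval x = 1)
    {lt : FormalComm r → FormalComm r → Prop} (hst : IsStrictTotalOrder (FormalComm r) lt)
    (hlow : ∀ α β : FormalComm r, α.totalWeight < β.totalWeight → lt α β)
    (B : FormalComm r → ℕ) (hB : ∀ α β, B α * B β ≤ B (bracket α β))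
    (cs : List (FormalComm r)) (hcs : IsBasicList lt n cs)
    (w : List (Fin r × Bool)) (hw : ∀ i, (w.map Prod.fst).count i ≤ B (letter i)) :
    ∃ l : FormalComm r → ℤ, (∀ c ∈ cs, |l c| ≤ (B c : ℤ)) ∧
      (w.map fun p => if p.2 then x p.1 else (x p.1)⁻¹).prod =
        (cs.map fun c => c.eval x ^ l c).prod := by
  set w₁ : List (FormalComm r × Bool) := w.map fun p => (letter p.1, p.2) with hw₁
  have hlet : ∀ p ∈ w₁, ∃ i, p.1 = letter i := by
    intro p hp
    obtain ⟨q, _, rfl⟩ := List.mem_map.1 hp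
    exact ⟨q.1, rfl⟩
  have heval : wordEval x w₁ = (w.map fun p => if p.2 then x p.1 else (x p.1)⁻¹).prod := by
    simp only [wordEval, hw₁, List.map_map]
    rfl
  have hocc : ∀ c, occ w₁ c ≤ B c := by
    intro c
    have hm : w₁.map Prod.fst = (w.map Prod.fst).map letter := by simp [hw₁]
    unfold occ
    rw [hm]
    cases c with
    | letter i =>
      rw [List.count_map_of_injective _ _ (fun a b h => by simpa using h)]
      exact hw i
    | bracket α β => simp [List.count_eq_zero_of_not_mem]
  obtain ⟨l, h1, h2⟩ := exists_collect_aux x n hx hst hlow B hB cs hcs.1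
    (fun c hc => ((hcs.2 c).1 hc).1) (fun c _ d hd hn _ => (hcs.2 d).2 ⟨hd, hn⟩)
    (w₁.filter fun p => p.1.totalWeight ≤ n)
    (fun p hp => by
      simp only [List.mem_filter, decide_eq_true_eq] at hp
      obtain ⟨i, hi⟩ := hlet p hp.1
      exact (hcs.2 _).2 ⟨hi ▸ .letter i, hp.2⟩)
    (fun p hp α γ h => by
      obtain ⟨i, hi⟩ := hlet p (List.mem_filter.1 hp).1
      simp [hi] at h)
    (fun c => le_trans ((List.filter_sublist.map _).count_le c) (hocc c))
  refine ⟨l, h1, ?_⟩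
  rw [← heval, ← h2, wordEval_filter x (fun c => c.totalWeight ≤ n) (fun c hc => hx c (by omega))]

end Collection

/-! ### Heavy commutators vanish in a nilpotent group. -/

section LowerCentralSeries

variable {G : Type u} [Group G]

/-- The three subgroups lemma, applied in `G ⧸ N`. -/
theorem commutator_commutator_le_of_rotate {H₁ H₂ H₃ N : Subgroup G} [N.Normal]
    (h1 : ⁅⁅H₂, H₃⁆, H₁⁆ ≤ N) (h2 : ⁅⁅H₃, H₁⁆, H₂⁆ ≤ N) : ⁅⁅H₁, H₂⁆, H₃⁆ ≤ N := by
  have key : ∀ H : Subgroup G, H ≤ N ↔ H.map (QuotientGroup.mk' N) = ⊥ := fun H => by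
    rw [Subgroup.map_eq_bot_iff, QuotientGroup.ker_mk']
  rw [key, Subgroup.map_commutator, Subgroup.map_commutator] at *
  exact Subgroup.commutator_commutator_eq_bot_of_rotate h1 h2

theorem commutator_lowerCentralSeries_le (j : ℕ) : ∀ i : ℕ,
    ⁅(⊤ : Subgroup G).lowerCentralSeries i, (⊤ : Subgroup G).lowerCentralSeries j⁆ ≤
      (⊤ : Subgroup G).lowerCentralSeries (i + j + 1) := by
  induction j with
  | zero => intro i; exact le_rfl
  | succ j ih =>
    intro i
    rw [Subgroup.commutator_comm, Subgroup.lowerCentralSeries_succ]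
    apply commutator_commutator_le_of_rotate
    · rw [Subgroup.commutator_comm ⊤]
      exact (ih (i + 1)).trans_eq (by congr 1; omega)
    · exact Subgroup.commutator_mono (ih i) le_rfl

theorem FormalComm.eval_mem_lowerCentralSeries {r : ℕ} (x : Fin r → G) (c : FormalComm r) :
    c.eval x ∈ (⊤ : Subgroup G).lowerCentralSeries (c.totalWeight - 1) := by
  induction c with
  | letter i => simp [totalWeight_letter]
  | bracket α β ha hb =>
    have h1 := α.totalWeight_pos
    have h2 := β.totalWeight_pos
    have h := Subgroup.commutator_mem_commutator (inv_mem ha) (inv_mem hb)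
    have h3 : (bracket α β).totalWeight - 1 = α.totalWeight - 1 + (β.totalWeight - 1) + 1 := by
      rw [totalWeight_bracket]; omega
    rw [h3]
    simpa [commutatorElement_def, FormalComm.eval] using commutator_lowerCentralSeries_le _ _ h

theorem FormalComm.eval_eq_one {r : ℕ} (x : Fin r → G) {n : ℕ}
    (hG : (⊤ : Subgroup G).lowerCentralSeries n = ⊥) (c : FormalComm r) (hc : n < c.totalWeight) :
    c.eval x = 1 := by
  have := Subgroup.lowerCentralSeries_antitone (⊤ : Subgroup G)
    (show n ≤ c.totalWeight - 1 by omega) (c.eval_mem_lowerCentralSeries x)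
  rwa [hG, Subgroup.mem_bot] at this

end LowerCentralSeries

/-! ### Substitution, counting and ordering of formal commutators. -/

section Formal

variable {r : ℕ}

theorem FormalComm.map_eval {G : Type*} {H : Type*} [Group G] [Group H] (f : G →* H)
    (x : Fin r → G) (c : FormalComm r) : f (c.eval x) = c.eval fun i => f (x i) := by
  induction c with
  | letter i => rfl
  | bracket α β ha hb => simp [FormalComm.eval, ha, hb]

/-- Substitution of formal commutators for the letters. -/
def FormalComm.subst {k : ℕ} (f : Fin k → FormalComm r) : FormalComm k → FormalComm r
  | letter i => f i
  | bracket α β => bracket (subst f α) (subst f β)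

theorem FormalComm.eval_subst {G : Type*} [Group G] {k : ℕ} (x : Fin r → G)
    (f : Fin k → FormalComm r) (c : FormalComm k) :
    (c.subst f).eval x = c.eval fun i => (f i).eval x := by
  induction c with
  | letter i => rfl
  | bracket α β ha hb => simp [FormalComm.eval, subst, ha, hb]

theorem FormalComm.totalWeight_subst {k : ℕ} (f : Fin k → FormalComm r) (c : FormalComm k) :
    (c.subst f).totalWeight = ∑ i, c.weight i * (f i).totalWeight := by
  induction c with
  | letter i => simp [subst, weight, Pi.single_apply]
  | bracket α β ha hb =>
    simp [subst, totalWeight_bracket, weight, ha, hb, add_mul, Finset.sum_add_distrib]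

/-- The monomial `L^χ(c)`. -/
def weightPow (L : Fin r → ℕ) (c : FormalComm r) : ℕ := ∏ i, L i ^ c.weight i

@[simp] theorem weightPow_letter (L : Fin r → ℕ) (i : Fin r) : weightPow L (letter i) = L i := by
  simp [weightPow, weight, Pi.single_apply, Finset.prod_ite_eq']

@[simp] theorem weightPow_bracket (L : Fin r → ℕ) (α β : FormalComm r) :
    weightPow L (bracket α β) = weightPow L α * weightPow L β := by
  simp [weightPow, weight, pow_add, Finset.prod_mul_distrib]

theorem weightPow_pos {L : Fin r → ℕ} (hL : ∀ i, 0 < L i) (c : FormalComm r) :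
    0 < weightPow L c :=
  Finset.prod_pos fun i _ => pow_pos (hL i) _

theorem weightPow_subst {k : ℕ} (L : Fin r → ℕ) (f : Fin k → FormalComm r) (c : FormalComm k) :
    weightPow L (c.subst f) = weightPow (fun i => weightPow L (f i)) c := by
  induction c with
  | letter i => simp [subst]
  | bracket α β ha hb => simp [subst, ha, hb]

theorem weightPow_const_mul (a : ℕ) (L : Fin r → ℕ) (c : FormalComm r) :
    weightPow (fun i => a * L i) c = a ^ c.totalWeight * weightPow L c := by
  simp [weightPow, mul_pow, Finset.prod_mul_distrib, totalWeight, Finset.prod_pow_eq_pow_sum]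

theorem weightPow_mono {L M : Fin r → ℕ} (h : ∀ i, L i ≤ M i) (c : FormalComm r) :
    weightPow L c ≤ weightPow M c :=
  Finset.prod_le_prod' fun i _ => Nat.pow_le_pow_left (h i) _

/-- A finite set containing the formal commutators of total weight at most `n`. -/
noncomputable def commsUpTo (r : ℕ) : ℕ → Finset (FormalComm r)
  | 0 => ∅
  | n + 1 => Finset.univ.image letter ∪
      Finset.image₂ bracket (commsUpTo r n) (commsUpTo r n)

theorem mem_commsUpTo {n : ℕ} : ∀ {c : FormalComm r}, c.totalWeight ≤ n → c ∈ commsUpTo r n := by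
  induction n with
  | zero => intro c h; have := c.totalWeight_pos; omega
  | succ n ih =>
    intro c h
    rw [commsUpTo, Finset.mem_union]
    cases c with
    | letter i => simp
    | bracket α β =>
      have h1 := α.totalWeight_pos
      have h2 := β.totalWeight_pos
      rw [totalWeight_bracket] at h
      exact .inr (Finset.mem_image₂.2 ⟨α, ih (by omega), β, ih (by omega), rfl⟩)

/-- The cardinalities satisfy `N_{n+1} ≤ r + N_n²`; the condition `r ≥ 2` absorbs the constant 2
into a power of `r`. -/
theorem exists_card_commsUpTo_le (n : ℕ) :
    ∃ C : ℕ, ∀ r : ℕ, 2 ≤ r → (commsUpTo r n).card ≤ r ^ C := by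
  induction n with
  | zero => exact ⟨0, fun r _ => by simp [commsUpTo]⟩
  | succ n ih =>
    obtain ⟨C, hC⟩ := ih
    refine ⟨2 * C + 2, fun r hr => ?_⟩
    have h1 : (Finset.univ.image (letter : Fin r → FormalComm r)).card ≤ r := by
      simpa using Finset.card_image_le (s := Finset.univ) (f := (letter : Fin r → FormalComm r))
    have h2 := Finset.card_image₂_le (bracket : FormalComm r → _ → _) (commsUpTo r n)
      (commsUpTo r n)
    have h3 := Nat.mul_le_mul (hC r hr) (hC r hr)
    have h4 : 1 ≤ r ^ C := Nat.one_le_pow _ _ (by omega)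
    have h5 := Finset.card_union_le (Finset.univ.image (letter : Fin r → FormalComm r))
      (Finset.image₂ bracket (commsUpTo r n) (commsUpTo r n))
    rw [commsUpTo]
    calc _ ≤ r + r ^ C * r ^ C := by omega
      _ ≤ r * (r ^ C * r ^ C) + r * (r ^ C * r ^ C) := by
        have : 1 ≤ r ^ C * r ^ C := Nat.mul_le_mul h4 h4
        exact Nat.add_le_add (by nlinarith) (by nlinarith)
      _ = 2 * (r * (r ^ C * r ^ C)) := by ring
      _ ≤ r * (r * (r ^ C * r ^ C)) := by gcongr
      _ = r ^ (2 * C + 2) := by ring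

theorem exists_sorted_list {α : Type*} {lt : α → α → Prop} (h : IsStrictTotalOrder α lt)
    (S : Finset α) : ∃ l : List α, l.Pairwise lt ∧ ∀ a, a ∈ l ↔ a ∈ S := by
  classical
  let := linearOrderOfSTO lt
  refine ⟨S.sort (· ≤ ·), ?_, fun a => by simp⟩
  exact (Finset.sortedLT_sort S).pairwise

theorem exists_isBasicList {lt : FormalComm r → FormalComm r → Prop}
    (h : IsStrictTotalOrder (FormalComm r) lt) (n : ℕ) :
    ∃ cs : List (FormalComm r), IsBasicList lt n cs := by
  classical
  obtain ⟨cs, h1, h2⟩ := exists_sorted_list h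
    ((commsUpTo r n).filter fun c => IsBasic lt c ∧ c.totalWeight ≤ n)
  refine ⟨cs, h1, fun c => ?_⟩
  rw [h2, Finset.mem_filter]
  exact ⟨fun h => h.2, fun h => ⟨mem_commsUpTo h.2, h⟩⟩

/-- In a bracket using one letter only, both entries would by induction be that letter, against `β ≺
α`. -/
theorem IsBasic.eq_letter {lt : FormalComm r → FormalComm r → Prop} (hirr : ∀ c, ¬ lt c c)
    {c : FormalComm r} (hc : IsBasic lt c) (i : Fin r) (h : ∀ j, j ≠ i → c.weight j = 0) :
    c = .letter i := by
  induction hc with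
  | letter k =>
    by_contra hk
    have hki : k ≠ i := fun e => hk (e ▸ rfl)
    simpa [weight] using h k hki
  | bracket α β _ _ hlt _ ha hb =>
    have h' : ∀ j, j ≠ i → α.weight j = 0 ∧ β.weight j = 0 := fun j hj => by
      simpa [weight] using h j hj
    rw [ha fun j hj => (h' j hj).1, hb fun j hj => (h' j hj).2] at hlt
    exact absurd hlt (hirr _)

/-- An injective numbering of the formal commutators. -/
def FormalComm.code : FormalComm r → ℕ
  | letter i => 2 * i
  | bracket α β => 2 * Nat.pair (code α) (code β) + 1

theorem FormalComm.code_injective : Function.Injective (code : FormalComm r → ℕ) := by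
  intro c
  induction c with
  | letter i =>
    intro d h
    cases d with
    | letter j => simp only [code] at h; congr 1; ext; omega
    | bracket α β => simp only [code] at h; omega
  | bracket α β ha hb =>
    intro d h
    cases d with
    | letter j => simp only [code] at h; omega
    | bracket γ δ =>
      simp only [code] at h
      have h' : Nat.pair (code α) (code β) = Nat.pair (code γ) (code δ) := by omega
      rw [Nat.pair_eq_pair] at h'
      rw [ha h'.1, hb h'.2]

/-- The ordering of the formal commutators by total weight and then by number. -/
def codeLt (α β : FormalComm r) : Prop :=
  α.totalWeight < β.totalWeight ∨ α.totalWeight = β.totalWeight ∧ α.code < β.code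

theorem isStrictTotalOrder_codeLt : IsStrictTotalOrder (FormalComm r) codeLt where
  irrefl a h := by unfold codeLt at h; omega
  trans a b c h h' := by unfold codeLt at *; omega
  trichotomous a b h h' := by
    apply code_injective
    unfold codeLt at *; omega

theorem codeLt_letter {i j : Fin r} : codeLt (letter i) (letter j) ↔ i < j := by
  simp [codeLt, totalWeight_letter, code]

end Formal

/-! ### The Heisenberg group, a class 2 test group for reading off exponents. -/

section Heisenberg

/-- The Heisenberg group over the integers. -/
@[ext]
structure Heis where
  /-- the first coordinate -/
  fst : ℤ
  /-- the second coordinate -/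
  snd : ℤ
  /-- the central coordinate -/
  cen : ℤ

namespace Heis

instance : Mul Heis := ⟨fun g h => ⟨g.fst + h.fst, g.snd + h.snd, g.cen + h.cen + g.fst * h.snd⟩⟩
instance : One Heis := ⟨⟨0, 0, 0⟩⟩
instance : Inv Heis := ⟨fun g => ⟨-g.fst, -g.snd, -g.cen + g.fst * g.snd⟩⟩

theorem mul_def (g h : Heis) :
    g * h = ⟨g.fst + h.fst, g.snd + h.snd, g.cen + h.cen + g.fst * h.snd⟩ := rfl
theorem one_def : (1 : Heis) = ⟨0, 0, 0⟩ := rfl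
theorem inv_def (g : Heis) : g⁻¹ = ⟨-g.fst, -g.snd, -g.cen + g.fst * g.snd⟩ := rfl

instance : Group Heis :=
  Group.ofLeftAxioms
    (fun a b c => by simp only [mul_def]; ext <;> simp only <;> ring)
    (fun a => by simp only [mul_def, one_def]; ext <;> simp only <;> ring)
    (fun a => by simp only [mul_def, one_def, inv_def]; ext <;> simp only <;> ring)

theorem zpow_of_mul_eq_zero (g : Heis) (hg : g.fst * g.snd = 0) (p : ℤ) :
    g ^ p = ⟨p * g.fst, p * g.snd, p * g.cen⟩ := by
  induction p with
  | zero => simp [one_def]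
  | succ n ih =>
    rw [zpow_add_one, ih, mul_def]
    ext <;> simp only
    · ring
    · ring
    · linear_combination (n : ℤ) * hg
  | pred n ih =>
    rw [zpow_sub_one, ih, mul_def, inv_def]
    ext <;> simp only
    · ring
    · ring
    · linear_combination ((n : ℤ) + 1) * hg

theorem eval_bracket {r : ℕ} (x : Fin r → Heis) (α β : FormalComm r) :
    (bracket α β).eval x =
      ⟨0, 0, (α.eval x).fst * (β.eval x).snd - (α.eval x).snd * (β.eval x).fst⟩ := by
  simp only [FormalComm.eval, mul_def, inv_def]
  ext <;> simp only <;> ring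

theorem eval_eq_one {r : ℕ} (x : Fin r → Heis) (c : FormalComm r) (hc : 3 ≤ c.totalWeight) :
    c.eval x = 1 := by
  cases c with
  | letter i => simp [totalWeight_letter] at hc
  | bracket α β =>
    rw [eval_bracket, one_def]
    cases α with
    | bracket α₁ α₂ => simp [eval_bracket]
    | letter i =>
      cases β with
      | bracket β₁ β₂ => simp [eval_bracket]
      | letter j => simp [totalWeight_letter, totalWeight_bracket] at hc

end Heis

end Heisenberg

/-! ### Expansion of the commutator of two powers. -/

section TwoLetters

theorem exists_two_letter_isBasicList (n : ℕ) (hn : 2 ≤ n) :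
    ∃ cs : List (FormalComm 2), IsBasicList codeLt n
        (letter 0 :: letter 1 :: bracket (letter 1) (letter 0) :: cs) ∧
      ∀ c ∈ cs, 3 ≤ c.totalWeight ∧ c.totalWeight ≤ n ∧ 0 < c.weight 0 ∧ 0 < c.weight 1 := by
  classical
  have hst := isStrictTotalOrder_codeLt (r := 2)
  have hirr : ∀ c : FormalComm 2, ¬ codeLt c c := hst.irrefl
  have hlow : ∀ c d : FormalComm 2, c.totalWeight < d.totalWeight → codeLt c d :=
    fun c d h => .inl h
  have hw1 : ∀ i : Fin 2, (letter i).totalWeight = 1 := totalWeight_letter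
  have hw2 : ∀ i j : Fin 2, (bracket (letter i) (letter j)).totalWeight = 2 := fun i j => by
    rw [totalWeight_bracket, hw1, hw1]
  have h01 : codeLt (letter (0 : Fin 2)) (letter 1) := codeLt_letter.2 (by decide)
  obtain ⟨cs, h1, h2⟩ := exists_sorted_list hst ((commsUpTo 2 n).filter fun c =>
    IsBasic codeLt c ∧ 3 ≤ c.totalWeight ∧ c.totalWeight ≤ n)
  have hmem : ∀ c, c ∈ cs ↔ IsBasic codeLt c ∧ 3 ≤ c.totalWeight ∧ c.totalWeight ≤ n :=
    fun c => by
      rw [h2, Finset.mem_filter]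
      exact ⟨fun h => h.2, fun h => ⟨mem_commsUpTo h.2.2, h⟩⟩
  refine ⟨cs, ⟨?_, ?_⟩, ?_⟩
  · simp only [List.pairwise_cons, List.mem_cons]
    refine ⟨?_, ?_, ?_, h1⟩
    · rintro c (rfl | rfl | hc)
      · exact h01
      · exact hlow _ _ (by rw [hw1, hw2]; omega)
      · exact hlow _ _ (by have := ((hmem c).1 hc).2.1; rw [hw1]; omega)
    · rintro c (rfl | hc)
      · exact hlow _ _ (by rw [hw1, hw2]; omega)
      · exact hlow _ _ (by have := ((hmem c).1 hc).2.1; rw [hw1]; omega)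
    · intro c hc
      exact hlow _ _ (by have := ((hmem c).1 hc).2.1; rw [hw2]; omega)
  · intro c
    simp only [List.mem_cons, hmem]
    constructor
    · rintro (rfl | rfl | rfl | hc)
      · exact ⟨.letter 0, by rw [hw1]; omega⟩
      · exact ⟨.letter 1, by rw [hw1]; omega⟩
      · exact ⟨.bracket _ _ (.letter 1) (.letter 0) h01 (by simp), by rw [hw2]; omega⟩
      · exact ⟨hc.1, hc.2.2⟩
    · rintro ⟨hb, hc⟩
      by_cases h3 : 3 ≤ c.totalWeight
      · exact .inr (.inr (.inr ⟨hb, h3, hc⟩))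
      cases hb with
      | letter i => fin_cases i <;> simp
      | bracket α β ha hb hlt _ =>
        rw [totalWeight_bracket] at h3
        have ha' := α.totalWeight_pos
        have hb' := β.totalWeight_pos
        cases ha with
        | bracket α₁ α₂ =>
          have := α₁.totalWeight_pos
          have := α₂.totalWeight_pos
          rw [totalWeight_bracket] at h3
          omega
        | letter i =>
          cases hb with
          | bracket β₁ β₂ =>
            have := β₁.totalWeight_pos
            have := β₂.totalWeight_pos
            rw [totalWeight_bracket] at h3
            omega
          | letter j =>
            rw [codeLt_letter] at hlt
            have hj : j = 0 := by omega
            have hi : i = 1 := by omega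
            simp [hi, hj]
  · intro c hc
    obtain ⟨hb, h3, hn⟩ := (hmem c).1 hc
    have key : ∀ i j : Fin 2, (∀ k, k ≠ i → k = j) → 0 < c.weight j := by
      intro i j hij
      by_contra h0
      have := hb.eq_letter hirr i fun k hk => by rw [hij k hk]; omega
      rw [this, hw1] at h3
      omega
    exact ⟨h3, hn, key 1 0 (by decide), key 0 1 (by decide)⟩

/-- The word `x_i ^ p`. -/
def zpowWord {r : ℕ} (i : Fin r) (p : ℤ) : List (Fin r × Bool) :=
  List.replicate p.natAbs (i, decide (0 ≤ p))

theorem prod_zpowWord {G : Type u} [Group G] {r : ℕ} (x : Fin r → G) (i : Fin r) (p : ℤ) :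
    ((zpowWord i p).map fun p => if p.2 then x p.1 else (x p.1)⁻¹).prod = x i ^ p := by
  unfold zpowWord
  rw [List.map_replicate, List.prod_replicate]
  by_cases hp : 0 ≤ p
  · obtain ⟨k, rfl⟩ := Int.eq_ofNat_of_zero_le hp
    simp
  · obtain ⟨k, hk⟩ := Int.eq_ofNat_of_zero_le (show 0 ≤ -p by omega)
    have : p = -(k : ℤ) := by omega
    subst this
    rw [Int.natAbs_neg, Int.natAbs_natCast]
    simp only [decide_eq_true_eq, hp, if_false, zpow_neg, zpow_natCast, inv_pow]

theorem count_zpowWord {r : ℕ} (i j : Fin r) (p : ℤ) :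
    ((zpowWord i p).map Prod.fst).count j = if i = j then p.natAbs else 0 := by
  simp [zpowWord, List.count_replicate]

/-- The expansion of `[a ^ p, b ^ q]` as `[a, b] ^ (p q)` times powers of higher commutators in `a`
and `b`, with bounds for the exponents. -/
theorem exists_commutator_zpow (n : ℕ) (hn : 2 ≤ n) :
    ∃ cs : List (FormalComm 2),
      (∀ c ∈ cs, 3 ≤ c.totalWeight ∧ c.totalWeight ≤ n ∧ 0 < c.weight 0 ∧ 0 < c.weight 1) ∧
      ∀ (G : Type u) [Group G] (x : Fin 2 → G)
        (_ : ∀ c : FormalComm 2, n < c.totalWeight → c.eval x = 1) (p q : ℤ),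
        ∃ l : FormalComm 2 → ℤ,
          (∀ c ∈ cs, |l c| ≤ (weightPow ![2 * q.natAbs, 2 * p.natAbs] c : ℤ)) ∧
          (x 1 ^ p)⁻¹ * (x 0 ^ q)⁻¹ * x 1 ^ p * x 0 ^ q =
            ((x 1)⁻¹ * (x 0)⁻¹ * x 1 * x 0) ^ (p * q) * (cs.map fun c => c.eval x ^ l c).prod := by
  obtain ⟨cs, h1, h2⟩ := exists_two_letter_isBasicList n hn
  refine ⟨cs, h2, fun G _ x hx p q => ?_⟩
  -- Collecting in `G × Heis` makes the same exponents valid in both factors. In `Heis` commutators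
  -- of weight at least 3 die, which forces the first three exponents to be `0`, `0`, `p * q`.
  set y : Fin 2 → Heis := ![⟨0, 1, 0⟩, ⟨1, 0, 0⟩] with hy
  set z : Fin 2 → G × Heis := fun i => (x i, y i) with hz
  have hfst : ∀ c : FormalComm 2, (c.eval z).1 = c.eval x :=
    fun c => map_eval (MonoidHom.fst G Heis) z c
  have hsnd : ∀ c : FormalComm 2, (c.eval z).2 = c.eval y :=
    fun c => map_eval (MonoidHom.snd G Heis) z c
  obtain ⟨l, hl1, hl2⟩ := exists_collect z n
    (fun c hc => Prod.ext ((hfst c).trans (hx c hc))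
      ((hsnd c).trans (Heis.eval_eq_one y c (by omega))))
    isStrictTotalOrder_codeLt (fun α β h => .inl h)
    (weightPow ![2 * q.natAbs, 2 * p.natAbs]) (fun α β => (weightPow_bracket _ α β).ge) _ h1
    (zpowWord 1 (-p) ++ zpowWord 0 (-q) ++ zpowWord 1 p ++ zpowWord 0 q)
    (fun i => by
      simp only [List.map_append, List.count_append, count_zpowWord, weightPow_letter]
      fin_cases i <;> simp <;> omega)
  simp only [List.map_append, List.prod_append, prod_zpowWord, List.map_cons,
    List.prod_cons] at hl2
  have e1 := congrArg (MonoidHom.fst G Heis) hl2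
  have e2 := congrArg (MonoidHom.snd G Heis) hl2
  simp only [map_mul, map_list_prod, map_zpow, List.map_map, Function.comp_def,
    MonoidHom.coe_fst, MonoidHom.coe_snd, Prod.pow_fst, Prod.pow_snd, hfst, hsnd] at e1 e2
  have hone : (cs.map fun c => c.eval y ^ l c).prod = 1 :=
    List.prod_eq_one fun g hg => by
      obtain ⟨c, hc, rfl⟩ := List.mem_map.1 hg
      rw [Heis.eval_eq_one y c (h2 c hc).1, one_zpow]
  rw [hone, mul_one, Heis.eval_bracket] at e2
  simp only [hz, FormalComm.eval, hy, Matrix.cons_val_zero, Matrix.cons_val_one] at e2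
  rw [Heis.zpow_of_mul_eq_zero _ (by simp), Heis.zpow_of_mul_eq_zero _ (by simp),
    Heis.zpow_of_mul_eq_zero _ (by simp), Heis.zpow_of_mul_eq_zero _ (by simp),
    Heis.zpow_of_mul_eq_zero _ (by simp), Heis.zpow_of_mul_eq_zero _ (by simp),
    Heis.zpow_of_mul_eq_zero _ (by simp)] at e2
  simp only [Heis.mul_def, Heis.mk.injEq] at e2
  obtain ⟨e3, e4, e5⟩ := e2
  have l0 : l (letter 0) = 0 := by linarith
  have l1 : l (letter 1) = 0 := by linarith
  have l2 : l (bracket (letter 1) (letter 0)) = p * q := by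
    rw [l0, l1] at e5
    linarith
  rw [l0, l1, l2] at e1
  refine ⟨l, fun c hc => hl1 c (by simp [hc]), ?_⟩
  simpa [FormalComm.eval, mul_assoc] using e1

end TwoLetters

/-! ### Products in powers of a set. -/

section PowersOfSets

variable {G : Type u} [Group G] {A : Set G}

theorem mul_mem_set_pow {g h : G} {m n : ℕ} (hg : g ∈ A ^ m) (hh : h ∈ A ^ n) :
    g * h ∈ A ^ (m + n) := by
  rw [pow_add]; exact Set.mul_mem_mul hg hh

theorem inv_mem_set_pow (hA : A⁻¹ = A) {g : G} {m : ℕ} (hg : g ∈ A ^ m) : g⁻¹ ∈ A ^ m := by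
  rw [← Set.inv_mem_inv, ← inv_pow, hA] at hg
  exact hg

theorem list_prod_mem_set_pow (K : ℕ) (l : List G) (hl : ∀ g ∈ l, g ∈ A ^ K) :
    l.prod ∈ A ^ (K * l.length) := by
  induction l with
  | nil => simp
  | cons g l ih =>
    rw [List.prod_cons, List.length_cons, mul_add, mul_one, add_comm]
    exact mul_mem_set_pow (hl g (by simp)) (ih fun h hh => hl h (by simp [hh]))

theorem zpow_mem_set_pow_mul (g : G) (K W N : ℕ) (h : ∀ l : ℤ, |l| ≤ (W : ℤ) → g ^ l ∈ A ^ K) :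
    ∀ l : ℤ, |l| ≤ ((N * W : ℕ) : ℤ) → g ^ l ∈ A ^ (K * N) := by
  induction N with
  | zero =>
    intro l hl
    have : l = 0 := by simpa using hl
    simp [this]
  | succ N ih =>
    intro l hl
    have hW : (0 : ℤ) ≤ W := by positivity
    have hNW : (0 : ℤ) ≤ ((N * W : ℕ) : ℤ) := by positivity
    have hs : (((N + 1) * W : ℕ) : ℤ) = ((N * W : ℕ) : ℤ) + W := by push_cast; ring
    rw [hs] at hl
    obtain ⟨a, b, rfl, ha, hb⟩ : ∃ a b : ℤ, l = a + b ∧ |a| ≤ ((N * W : ℕ) : ℤ) ∧ |b| ≤ (W : ℤ) := by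
      rw [abs_le] at hl
      -- Clamp `l` to `[-NW, NW]`; the excess has absolute value at most `W`.
      refine ⟨max (-((N * W : ℕ) : ℤ)) (min l ((N * W : ℕ) : ℤ)),
        l - max (-((N * W : ℕ) : ℤ)) (min l ((N * W : ℕ) : ℤ)), by ring, ?_, ?_⟩ <;>
      · rw [abs_le]; omega
    rw [zpow_add, mul_add, mul_one]
    exact mul_mem_set_pow (ih a ha) (h b hb)

end PowersOfSets

/-! ### Powers of commutators as bounded products of powers of the letters. -/

section Generation

variable {G : Type u} [Group G] {r : ℕ}

/-- The set of powers `x_i ^ m` with `|m| ≤ L_i`, together with `1`. -/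
def letterPowers (x : Fin r → G) (L : Fin r → ℕ) : Set G :=
  insert 1 {g | ∃ (i : Fin r) (m : ℤ), |m| ≤ (L i : ℤ) ∧ g = x i ^ m}

theorem inv_letterPowers (x : Fin r → G) (L : Fin r → ℕ) :
    (letterPowers x L)⁻¹ = letterPowers x L := by
  have h : ∀ g ∈ letterPowers x L, g⁻¹ ∈ letterPowers x L := by
    rintro g (rfl | ⟨i, m, hm, rfl⟩)
    · exact .inl inv_one
    · exact .inr ⟨i, -m, by rwa [abs_neg], (zpow_neg _ _).symm⟩
  ext g
  rw [Set.mem_inv]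
  exact ⟨fun hg => by simpa using h _ hg, h g⟩

theorem image_letterPowers {H : Type u} [Group H] (f : G →* H) (x : Fin r → G) (L : Fin r → ℕ) :
    letterPowers (fun i => f (x i)) L ⊆ f '' letterPowers x L := by
  rintro g (rfl | ⟨i, m, hm, rfl⟩)
  · exact ⟨1, .inl rfl, map_one f⟩
  · exact ⟨x i ^ m, .inr ⟨i, m, hm, rfl⟩, map_zpow f _ _⟩

theorem commutator_mul_central {z u b : G} (hz : ∀ g, z * g = g * z) :
    (u * z)⁻¹ * b⁻¹ * (u * z) * b = u⁻¹ * b⁻¹ * u * b := by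
  calc _ = z⁻¹ * (u⁻¹ * b⁻¹ * u * (z * b)) := by group
    _ = z⁻¹ * (u⁻¹ * b⁻¹ * u * b * z) := by rw [hz b]; group
    _ = _ := by rw [← hz]; group

theorem exists_zpow_eval_mem (s : ℕ) : ∃ K : ℕ, ∀ (G : Type u) [Group G],
    (⊤ : Subgroup G).lowerCentralSeries s = ⊥ →
    ∀ (r : ℕ) (x : Fin r → G) (L : Fin r → ℕ), (∀ i, 0 < L i) →
    ∀ (c : FormalComm r) (l : ℤ), |l| ≤ (weightPow L c : ℤ) →
      c.eval x ^ l ∈ letterPowers x L ^ K := by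
  induction s with
  | zero =>
    refine ⟨0, fun G _ hG r x L _ c l _ => ?_⟩
    have : c.eval x = 1 := by
      rw [← Subgroup.mem_bot, ← hG]; simp
    simp [this]
  | succ s ih =>
    obtain ⟨K₀, hK₀⟩ := ih
    -- Modulo the central subgroup `Z`, both powers are products `u`, `v` of `K₀` letter powers;
    -- central factors cancel in a commutator, leaving `[u, v]` of length `4 * K₀`.
    have hcomm : ∀ (G : Type u) [Group G], (⊤ : Subgroup G).lowerCentralSeries (s + 1) = ⊥ →
        ∀ (r : ℕ) (x : Fin r → G) (L : Fin r → ℕ), (∀ i, 0 < L i) →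
        ∀ (α β : FormalComm r) (p q : ℤ), |p| ≤ (weightPow L α : ℤ) → |q| ≤ (weightPow L β : ℤ) →
        (α.eval x ^ p)⁻¹ * (β.eval x ^ q)⁻¹ * α.eval x ^ p * β.eval x ^ q ∈
          letterPowers x L ^ (4 * K₀) := by
      intro G _ hG r x L hL α β p q hp hq
      set Z := (⊤ : Subgroup G).lowerCentralSeries s with hZ
      have hcen : ∀ z ∈ Z, ∀ g, z * g = g * z := by
        intro z hz g
        rw [Subgroup.lowerCentralSeries_succ, Subgroup.commutator_top_right_eq_bot_iff_le_center]
          at hG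
        exact (Subgroup.mem_center_iff.1 (hG hz) g).symm
      have hquot : (⊤ : Subgroup (G ⧸ Z)).lowerCentralSeries s = ⊥ := by
        rw [← Subgroup.map_top_of_surjective (QuotientGroup.mk' Z)
          (QuotientGroup.mk'_surjective Z), ← Subgroup.map_lowerCentralSeries,
          Subgroup.map_eq_bot_iff, QuotientGroup.ker_mk']
      have hlift : ∀ (c : FormalComm r) (l : ℤ), |l| ≤ (weightPow L c : ℤ) →
          ∃ u ∈ letterPowers x L ^ K₀, ∃ z ∈ Z, c.eval x ^ l = u * z := by
        intro c l hl
        have h1 := hK₀ (G ⧸ Z) hquot r (fun i => QuotientGroup.mk' Z (x i)) L hL c l hl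
        rw [← map_eval, ← map_zpow] at h1
        have h2 := Set.pow_subset_pow_left (image_letterPowers (QuotientGroup.mk' Z) x L) h1
        rw [← Set.image_pow] at h2
        obtain ⟨u, hu, hu'⟩ := h2
        exact ⟨u, hu, u⁻¹ * c.eval x ^ l, QuotientGroup.eq.1 hu', by group⟩
      obtain ⟨u, hu, z, hz, hu'⟩ := hlift α p hp
      obtain ⟨v, hv, z', hz', hv'⟩ := hlift β q hq
      have hA := inv_letterPowers x L
      have : (α.eval x ^ p)⁻¹ * (β.eval x ^ q)⁻¹ * α.eval x ^ p * β.eval x ^ q =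
          u⁻¹ * v⁻¹ * u * v := by
        rw [hu', commutator_mul_central (hcen z hz), hv']
        have := commutator_mul_central (u := v) (b := u) (hcen z' hz')
        rw [← inv_inj]
        simpa [mul_assoc] using this
      rw [this, show 4 * K₀ = K₀ + K₀ + K₀ + K₀ by ring]
      exact mul_mem_set_pow (mul_mem_set_pow (mul_mem_set_pow (inv_mem_set_pow hA hu)
        (inv_mem_set_pow hA hv)) hu) hv
    -- The list is fixed before the group, so its length may enter the constant. The cutoff `s + 2`
    -- is at least 2 even for `s = 0`.
    obtain ⟨cs, hcs, hexp⟩ := exists_commutator_zpow.{u} (s + 2) (by omega)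
    -- Descending induction on the weight: `j = 0` covers only trivial commutators, `j = s + 2`
    -- covers all.
    have hind : ∀ j : ℕ, ∃ K : ℕ, ∀ (G : Type u) [Group G],
        (⊤ : Subgroup G).lowerCentralSeries (s + 1) = ⊥ →
        ∀ (r : ℕ) (x : Fin r → G) (L : Fin r → ℕ), (∀ i, 0 < L i) →
        ∀ c : FormalComm r, s + 2 ≤ c.totalWeight + j → ∀ l : ℤ, |l| ≤ (weightPow L c : ℤ) →
          c.eval x ^ l ∈ letterPowers x L ^ K := by
      intro j
      induction j with
      | zero =>
        refine ⟨0, fun G _ hG r x L _ c hc l _ => ?_⟩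
        simp [eval_eq_one x hG c (by omega)]
      | succ j ihj =>
        obtain ⟨K, hK⟩ := ihj
        set M := 4 * K₀ + K * 2 ^ (s + 2) * cs.length with hM
        refine ⟨M + M + 1, fun G _ hG r x L hL c hc l hl => ?_⟩
        have h1 : (1 : G) ∈ letterPowers x L := .inl rfl
        cases c with
        | letter i =>
          refine Set.pow_subset_pow_right h1 (show 1 ≤ M + M + 1 by omega) ?_
          rw [pow_one]
          exact .inr ⟨i, l, by simpa using hl, rfl⟩
        | bracket α β =>
          have hmul : ∀ p q : ℤ, |p| ≤ (weightPow L α : ℤ) → |q| ≤ (weightPow L β : ℤ) →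
              (bracket α β).eval x ^ (p * q) ∈ letterPowers x L ^ M := by
            intro p q hp hq
            set f : Fin 2 → FormalComm r := ![β, α] with hf
            obtain ⟨e, he1, he2⟩ := hexp G (fun i => (f i).eval x)
              (fun d hd => eval_eq_one _ hG d (by omega)) p q
            simp only [hf, Matrix.cons_val_zero, Matrix.cons_val_one] at he2
            have he3 : (bracket α β).eval x ^ (p * q) =
                ((α.eval x ^ p)⁻¹ * (β.eval x ^ q)⁻¹ * α.eval x ^ p * β.eval x ^ q) *
                  (cs.map fun d => d.eval (fun i => (f i).eval x) ^ e d).prod⁻¹ := by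
              rw [eq_mul_inv_iff_mul_eq, he2]
              rfl
            rw [he3]
            refine mul_mem_set_pow (hcomm G hG r x L hL α β p q hp hq)
              (inv_mem_set_pow (inv_letterPowers x L) ?_)
            rw [← List.length_map (as := cs) (fun d => d.eval (fun i => (f i).eval x) ^ e d)]
            refine list_prod_mem_set_pow _ _ fun g hg => ?_
            obtain ⟨d, hd, rfl⟩ := List.mem_map.1 hg
            obtain ⟨hd3, hdn, hd0, hd1⟩ := hcs d hd
            rw [← eval_subst]
            refine zpow_mem_set_pow_mul _ K (weightPow L (d.subst f)) _
              (fun l hl => hK G hG r x L hL _ ?_ l hl) _ ((he1 d hd).trans ?_)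
            -- Both letters occur in `d` and its weight is at least 3, so substituting `β`, `α`
            -- gives weight exceeding that of `[α, β]`.
            · have ha := α.totalWeight_pos
              have hb := β.totalWeight_pos
              rw [totalWeight_bracket] at hc
              rw [totalWeight_subst, Fin.sum_univ_two]
              have hsum : d.totalWeight = d.weight 0 + d.weight 1 := Fin.sum_univ_two _
              rw [hsum] at hd3
              simp only [hf, Matrix.cons_val_zero, Matrix.cons_val_one]
              obtain ⟨a, ha'⟩ := Nat.exists_eq_add_of_lt hd0
              obtain ⟨b, hb'⟩ := Nat.exists_eq_add_of_lt hd1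
              rw [ha', hb'] at hd3 ⊢
              have : 1 ≤ a + b := by omega
              rcases Nat.eq_zero_or_pos a with h | h <;> nlinarith
            · rw [weightPow_subst]
              have hle : ∀ i, (![2 * q.natAbs, 2 * p.natAbs] : Fin 2 → ℕ) i ≤
                  2 * weightPow L (f i) := by
                have hp' : p.natAbs ≤ weightPow L α := by zify; exact hp
                have hq' : q.natAbs ≤ weightPow L β := by zify; exact hq
                intro i
                fin_cases i <;> simp [hf, hp', hq']
              have := weightPow_mono hle d
              rw [weightPow_const_mul] at this
              exact_mod_cast this.trans (Nat.mul_le_mul_right _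
                (Nat.pow_le_pow_right (by norm_num) hdn))
          have hA : (0 : ℤ) < weightPow L α := by exact_mod_cast weightPow_pos hL α
          have hB : (0 : ℤ) < weightPow L β := by exact_mod_cast weightPow_pos hL β
          -- Write `l = p * N + ρ` with `N = L^χ(β)`; then `(p, N)` and `(1, ρ)` are both admissible
          -- pairs for `hmul`.
          rw [weightPow_bracket, Nat.cast_mul, abs_le] at hl
          have hq1 : -(weightPow L α : ℤ) ≤ l / weightPow L β := by
            rw [Int.le_ediv_iff_mul_le hB]; linarith
          have hq2 : l / weightPow L β ≤ (weightPow L α : ℤ) :=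
            Int.ediv_le_of_le_mul hB (by linarith)
          have hr1 := Int.emod_nonneg l hB.ne'
          have hr2 := Int.emod_lt_of_pos l hB
          rw [← Int.ediv_mul_add_emod l (weightPow L β), zpow_add]
          refine Set.pow_subset_pow_right h1 (Nat.le_succ _)
            (mul_mem_set_pow (hmul _ _ (abs_le.2 ⟨hq1, hq2⟩) (by simp)) ?_)
          rw [← one_mul (l % _)]
          exact hmul 1 _ (by rw [abs_one]; omega) (abs_le.2 ⟨by omega, hr2.le⟩)
    obtain ⟨K, hK⟩ := hind (s + 2)
    exact ⟨K, fun G _ hG r x L hL c l hl => hK G hG r x L hL c (by omega) l hl⟩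

end Generation

/-! ### The three inclusions. -/

section Inclusions

variable {G : Type u} [Group G] {r : ℕ}

theorem orderedProgression_subset_nilprogression (x : Fin r → G) (L : Fin r → ℕ) :
    orderedProgression x L ⊆ nilprogression x L := by
  rintro g ⟨l, hl, rfl⟩
  refine ⟨(List.finRange r).flatMap fun i => zpowWord i (l i), fun i => ?_, ?_⟩
  · rw [List.map_flatMap, List.count_flatMap]
    simp only [Function.comp_def, count_zpowWord]
    rw [← List.ofFn_eq_map, List.sum_ofFn, Finset.sum_ite_eq']
    have : (l i).natAbs ≤ L i := by zify; exact hl i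
    simpa using this
  · rw [List.ofFn_eq_map]
    induction List.finRange r with
    | nil => rfl
    | cons i is ih =>
      rw [List.flatMap_cons, List.map_append, List.prod_append, prod_zpowWord, ← ih,
        List.map_cons, List.prod_cons]

theorem nilprogression_subset_nilpotentProgression [Group.IsNilpotent G]
    {lt : FormalComm r → FormalComm r → Prop} (hlt : IsCommOrder lt) (x : Fin r → G)
    (L : Fin r → ℕ) : nilprogression x L ⊆ nilpotentProgression lt x L := by
  rintro g ⟨w, hw, rfl⟩
  obtain ⟨cs, hcs⟩ := exists_isBasicList hlt.strictTotal (Group.nilpotencyClass G)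
  obtain ⟨l, h1, h2⟩ := exists_collect x (Group.nilpotencyClass G)
    (eval_eq_one x Subgroup.lowerCentralSeries_nilpotencyClass) hlt.strictTotal hlt.lowerFirst
    (weightPow L) (fun α β => (weightPow_bracket L α β).ge) cs hcs w (by simpa using hw)
  exact ⟨cs, l, hcs, h1, h2⟩

theorem letterPowers_subset_orderedProgression (x : Fin r → G) (L : Fin r → ℕ) :
    letterPowers x L ⊆ orderedProgression x L := by
  rintro g (rfl | ⟨i, m, hm, rfl⟩)
  · exact ⟨0, by simp, by simp⟩
  · refine ⟨Pi.single i m, fun j => ?_, ?_⟩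
    · by_cases h : j = i
      · subst h; simpa using hm
      · simp [h]
    · rw [List.ofFn_eq_map, List.prod_map_eq_pow_single i _ fun j hj _ => by simp [hj],
        List.count_eq_one_of_mem (List.nodup_finRange r) (List.mem_finRange i)]
      simp

theorem one_mem_orderedProgression (x : Fin r → G) (L : Fin r → ℕ) :
    1 ∈ orderedProgression x L :=
  letterPowers_subset_orderedProgression x L (.inl rfl)

theorem IsBasicList.length_le {lt : FormalComm r → FormalComm r → Prop}
    (hirr : ∀ c, ¬ lt c c) {n s : ℕ} (hn : n ≤ s) {cs : List (FormalComm r)}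
    (hcs : IsBasicList lt n cs) : cs.length ≤ (commsUpTo r s).card := by
  have hnd : cs.Nodup := hcs.1.imp fun {a b} h => by
    rintro rfl
    exact hirr _ h
  rw [← List.toFinset_card_of_nodup hnd]
  refine Finset.card_le_card fun c hc => ?_
  exact mem_commsUpTo (((hcs.2 c).1 (List.mem_toFinset.1 hc)).2.trans hn)

/-- For `r = 1` the power `r ^ C` leaves a single factor, so no constant may be lost; the only
possible basic commutator is the letter. -/
theorem nilpotentProgression_subset_of_subsingleton [Group.IsNilpotent G] [Subsingleton (Fin r)]
    {lt : FormalComm r → FormalComm r → Prop} (hirr : ∀ c, ¬ lt c c) (x : Fin r → G)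
    (L : Fin r → ℕ) : nilpotentProgression lt x L ⊆ orderedProgression x L := by
  rintro g ⟨cs, l, hcs, hl, rfl⟩
  have hlet : ∀ c ∈ cs, ∃ i, c = letter i := by
    intro c hc
    obtain ⟨i, hi⟩ : ∃ i, 0 < c.weight i := by
      by_contra! h
      have := c.totalWeight_pos
      exact this.ne' (Finset.sum_eq_zero fun i _ => Nat.le_zero.1 (h i))
    exact ⟨i, ((hcs.2 c).1 hc).1.eq_letter hirr i fun j hj => absurd (Subsingleton.elim j i) hj⟩
  cases cs with
  | nil => exact one_mem_orderedProgression x L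
  | cons c cs =>
    obtain ⟨i, rfl⟩ := hlet c (by simp)
    cases cs with
    | cons d cs =>
      obtain ⟨j, rfl⟩ := hlet d (by simp)
      have := (List.pairwise_cons.1 hcs.1).1 (letter j) (by simp)
      rw [Subsingleton.elim j i] at this
      exact absurd this (hirr _)
    | nil =>
      refine letterPowers_subset_orderedProgression x L (.inr ⟨i, l (letter i), ?_, ?_⟩)
      · have := hl (letter i) (by simp)
        rwa [show ∏ j, L j ^ (letter i).weight j = L i from weightPow_letter L i] at this
      · simp [FormalComm.eval]

theorem exists_nilpotentProgression_subset (s : ℕ) : ∃ C : ℕ, 0 < C ∧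
    ∀ (G : Type u) [Group G] [Group.IsNilpotent G], Group.nilpotencyClass G ≤ s →
      ∀ (r : ℕ), 2 ≤ r → ∀ (x : Fin r → G) (L : Fin r → ℕ), (∀ i, 0 < L i) →
      ∀ lt : FormalComm r → FormalComm r → Prop, (∀ c, ¬ lt c c) →
        nilpotentProgression lt x L ⊆ orderedProgression x L ^ (r ^ C) := by
  obtain ⟨K, hK⟩ := exists_zpow_eval_mem.{u} s
  obtain ⟨C, hC⟩ := exists_card_commsUpTo_le s
  refine ⟨K + C + 1, by omega, fun G _ _ hG r hr x L hL lt hirr => ?_⟩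
  rintro g ⟨cs, l, hcs, hl, rfl⟩
  have h1 := list_prod_mem_set_pow (A := letterPowers x L) K (cs.map fun c => c.eval x ^ l c)
    fun g hg => by
      obtain ⟨c, hc, rfl⟩ := List.mem_map.1 hg
      exact hK G (Subgroup.lowerCentralSeries_eq_bot_iff_nilpotencyClass_le.2 hG) r x L hL c _
        (hl c hc)
  refine Set.pow_subset_pow (letterPowers_subset_orderedProgression x L)
    (one_mem_orderedProgression x L) ?_ h1
  rw [List.length_map]
  calc K * cs.length ≤ r ^ K * r ^ C := by
        refine Nat.mul_le_mul ?_ ((hcs.length_le hirr hG).trans (hC r hr))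
        exact Nat.lt_two_pow_self.le.trans (Nat.pow_le_pow_left hr K)
    _ = r ^ (K + C) := (pow_add _ _ _).symm
    _ ≤ r ^ (K + C + 1) := Nat.pow_le_pow_right (by omega) (by omega)

end Inclusions

end NilProg

theorem mainTheorem8 (s : ℕ) :
    ∃ C : ℕ, ∀ (G : Type u) [Group G] [Group.IsNilpotent G], Group.nilpotencyClass G ≤ s →
      ∀ (r : ℕ) (x : Fin r → G) (L : Fin r → ℕ), (∀ i, 0 < L i) →
      ∀ lt : NilProg.FormalComm r → NilProg.FormalComm r → Prop, NilProg.IsCommOrder lt →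
        NilProg.orderedProgression x L ⊆ NilProg.nilprogression x L ∧
        NilProg.nilprogression x L ⊆ NilProg.nilpotentProgression lt x L ∧
        NilProg.nilpotentProgression lt x L ⊆ NilProg.orderedProgression x L ^ (r ^ C) := by
  obtain ⟨C, hC0, hC⟩ := NilProg.exists_nilpotentProgression_subset.{u} s
  refine ⟨C, fun G _ _ hG r x L hL lt hlt =>
    ⟨NilProg.orderedProgression_subset_nilprogression x L,
      NilProg.nilprogression_subset_nilpotentProgression hlt x L, ?_⟩⟩
  have hirr : ∀ c, ¬ lt c c := hlt.strictTotal.irrefl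
  rcases Nat.lt_or_ge r 2 with hr | hr
  · interval_cases r
    · rintro g ⟨cs, l, hcs, hl, rfl⟩
      have : cs = [] := List.eq_nil_iff_forall_not_mem.2 fun c _ => by
        have := c.totalWeight_pos
        simp [NilProg.FormalComm.totalWeight] at this
      -- Here `C > 0` matters: `0 ^ C = 0`, and the zeroth power of the set is `{1}`.
      rw [zero_pow hC0.ne', this]
      simp
    · rw [one_pow, pow_one]
      exact NilProg.nilpotentProgression_subset_of_subsingleton hirr x L
  · exact hC G hG r hr x L hL lt hirr
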